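/- **Conventions.** An ideal on a set $X$ is a nonempty family of subsets of $X$ closed under subsets and finite unions. For an ultrafilter $\mathcal U$ on $\omega$, $\mathcal U^*=\{\omega\setminus U:U\in\mathcal U\}$. For ideals $\mathcal I$ on $X$ and $\mathcal J$ on $Y$: $\mathcal I\le_K\mathcal J$ means that there is $f:Y\to X$ with $f^{-1}[I]\in\mathcal J$ for all $I\in\mathcal I$; $\mathcal I\cong_K\mathcal J$ means $\mathcal I\le_K\mathcal J$ and $\mathcal J\le_K\mathcal I$; they are isomorphic if there is a bijection $f:X\to Y$ with $f[A]\in\mathcal J\Leftrightarrow A\in\mathcal I$. An ideal on $X$ is analytic if it is an analytic subset of $2^X$. An ultrafilter $\mathcal U$ on $\omega$ is an $\mathcal I$-ultrafilter ($\mathcal I$ an ideal on $X$) if for every $f:\omega\to X$ there is $U\in\mathcal U$ with $f[U]\in\mathcal I$. For $\alpha<\omega_1$ define an ideal $fin^\alpha$ on a set $X_\alpha$: $X_0=\{0\}$, $fin^0=\{\emptyset\}$; $X_1=\omega$, $fin^1=fin$ is the ideal of finite sets; for $\alpha\ge1$, $X_{\alpha+1}=\omega\times X_\alpha$ and $A\in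 fin^{\alpha+1}$ iff $\{y:(n,y)\in A\}\in fin^\alpha$ for all but finitely many $n$; for limit $\alpha$, $X_\alpha=\bigcup_{\beta<\alpha}\{\beta\}\times X_\beta$ and $A\in fin^\alpha$ iff $\{\beta<\alpha:\{y:(\beta,y)\in A\}\notin fin^\beta\}$ is bounded in $\alpha$. An ultrafilter $\mathcal U$ on $\omega$ is a Shelah ultrafilter if (1) for every $1\le\alpha<\omega_1$ there is an ideal $\mathcal I\subseteq\mathcal U^*$ on $\omega$ isomorphic to $fin^\alpha$; and (2) for every analytic ideal $\mathcal I$ on $\omega$ with $\mathcal I\cap\mathcal U=\emptyset$ there are $\alpha<\omega_1$ and an ideal $\mathcal J\cong_K fin^\alpha$ with $\mathcal I\subseteq\mathcal J\subseteq\mathcal U^*$. The ideals: $nwd=\{A\subseteq\mathbb Q:A\text{ is nowhere dense}\}$; $\mathcal{ED}=\{A\subseteq\omega\times\omega:\exists m,n\,\forall k>n\ |\{l:(k,l)\in A\}|<m\}$ and $\mathcal{ED}_{fin}$ is its restriction to $\{(n,m):m\le n\}$; $\mathcal I_{1/n}=\{A\subseteq\omega:\sum_{n\in A}\frac1{n+1}<\infty\}$;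 $\mathcal Z=\{A\subseteq\omega:\lim_n|A\cap n|/n=0\}$; the Solecki ideal $\mathcal S$ is the ideal on $\Omega=\{A\subseteq2^\omega\text{ clopen}:\lambda(A)=1/2\}$, with $\lambda$ the normalized Haar measure on $2^\omega$, generated by the sets $I_x=\{A\in\Omega:x\in A\}$, $x\in2^\omega$. **Theorem.** Let $\mathcal U$ be a Shelah ultrafilter. (a) For each $\mathcal I\in\{\mathcal S,nwd,\mathcal{ED}_{fin},\mathcal I_{1/n},\mathcal Z\}$, $\mathcal U$ is an $\mathcal I$-ultrafilter. (b) For every analytic ideal $\mathcal I$ on $\omega$: $\mathcal I\le_K\mathcal U^*$ if and only if $\mathcal I\le_K fin^\alpha$ for some $\alpha<\omega_1$. -/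

import Mathlib

open Set Filter Topology MeasureTheory
open scoped Ordinal

/-! ## Ideals of sets

An ideal on `X` is a nonempty family of subsets of `X` closed under subsets and finite unions,
that is, `Order.Ideal (Set X)`. -/

/-- The ideal on `X` with a given carrier. -/
def setIdeal {X : Type} (C : Set (Set X)) (empty : ∅ ∈ C)
    (mono : ∀ A B : Set X, A ⊆ B → B ∈ C → A ∈ C)
    (union : ∀ A B : Set X, A ∈ C → B ∈ C → A ∪ B ∈ C) : Order.Ideal (Set X) where
  carrier := C
  lower' := fun B A h hB => mono A B h hB
  nonempty' := ⟨∅, empty⟩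
  directed' := fun A hA B hB => ⟨A ∪ B, union A B hA hB, subset_union_left, subset_union_right⟩

@[simp]
theorem mem_setIdeal {X : Type} {C : Set (Set X)} {h0 hm hu} {A : Set X} :
    A ∈ setIdeal C h0 hm hu ↔ A ∈ C := Iff.rfl

/-- The ideal generated by a family of sets: all sets covered by finitely many members. -/
def generatedIdeal {X : Type} (G : Set (Set X)) : Order.Ideal (Set X) :=
  setIdeal {A | ∃ F : Set (Set X), F.Finite ∧ F ⊆ G ∧ A ⊆ ⋃₀ F}
    ⟨∅, finite_empty, empty_subset _, empty_subset _⟩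
    (fun _ _ hAB ⟨F, h1, h2, h3⟩ => ⟨F, h1, h2, hAB.trans h3⟩)
    (fun _ _ ⟨F, h1, h2, h3⟩ ⟨F', h1', h2', h3'⟩ =>
      ⟨F ∪ F', h1.union h1', union_subset h2 h2', by
        rw [sUnion_union]; exact union_subset_union h3 h3'⟩)

/-- The dual ideal `{X \ U : U ∈ 𝓤}` of an ultrafilter. -/
def dualIdeal {X : Type} (U : Ultrafilter X) : Order.Ideal (Set X) :=
  setIdeal {A | Aᶜ ∈ U}
    (by
      change (∅ : Set X)ᶜ ∈ (U : Filter X)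
      rw [compl_empty]; exact Filter.univ_mem)
    (fun _ _ hAB hB => mem_of_superset hB (compl_subset_compl.2 hAB))
    (fun A B hA hB => by
      change (A ∪ B)ᶜ ∈ U
      rw [compl_union]; exact inter_mem hA hB)

/-- The restriction of an ideal to a set `Y`, as an ideal on `Y`. -/
def restrictIdeal {X : Type} (I : Order.Ideal (Set X)) (Y : Set X) : Order.Ideal (Set Y) :=
  setIdeal {A | (Subtype.val '' A : Set X) ∈ I}
    (by simpa using I.bot_mem)
    (fun _ _ hAB hB => I.lower (image_mono hAB) hB)
    (fun A B hA hB => by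
      change (Subtype.val '' (A ∪ B) : Set X) ∈ I
      rw [image_union]; exact I.sup_mem hA hB)

/-- The ideal `fin` of finite subsets of `ω`. -/
def finIdeal : Order.Ideal (Set ℕ) :=
  setIdeal {A | A.Finite} finite_empty (fun _ _ hAB hB => hB.subset hAB)
    (fun _ _ hA hB => hA.union hB)

/-- The ideal `bnd` of bounded subsets of a nonempty linear order. -/
def bndIdeal (L : Type) [LinearOrder L] [Nonempty L] : Order.Ideal (Set L) :=
  setIdeal {A | BddAbove A} bddAbove_empty (fun _ _ hAB hB => hB.mono hAB)
    (fun _ _ hA hB => hA.union hB)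

/-- The Fubini product `I × J`: the sets `A ⊆ X × Y` such that `A(b) ∈ J` for `I*`-all `b`. -/
def fubiniProd {X Y : Type} (I : Order.Ideal (Set X)) (J : Order.Ideal (Set Y)) :
    Order.Ideal (Set (X × Y)) :=
  setIdeal {A | {b | {y | (b, y) ∈ A} ∈ J}ᶜ ∈ I}
    (I.lower (fun _ hb => hb J.bot_mem) I.bot_mem)
    (fun _ _ hAB hB => I.lower
      (compl_subset_compl.2 fun _ hb => J.lower (fun _ hy => hAB hy) hb) hB)
    (fun _ _ hA hB => I.lower
      (fun b hb => by
        by_contra h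
        simp only [sup_eq_union, mem_union, mem_compl_iff, not_or, not_not] at h
        exact hb (J.sup_mem h.1 h.2)) (I.sup_mem hA hB))

/-- The ideal `lim_{i → I} J i`: the sets `A ⊆ ⋃ᵢ {i} × Yᵢ` with `A(i) ∈ J i` for `I*`-all `i`. -/
def limIdeal {X : Type} {Y : X → Type} (I : Order.Ideal (Set X))
    (J : ∀ i, Order.Ideal (Set (Y i))) : Order.Ideal (Set (Σ i, Y i)) :=
  setIdeal {A | {i | {y | Sigma.mk i y ∈ A} ∈ J i}ᶜ ∈ I}
    (I.lower (fun i hi => hi (J i).bot_mem) I.bot_mem)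
    (fun _ _ hAB hB => I.lower
      (compl_subset_compl.2 fun i hi => (J i).lower (fun _ hy => hAB hy) hi) hB)
    (fun _ _ hA hB => I.lower
      (fun i hi => by
        by_contra h
        simp only [sup_eq_union, mem_union, mem_compl_iff, not_or, not_not] at h
        exact hi ((J i).sup_mem h.1 h.2)) (I.sup_mem hA hB))

/-! ## Katětov order, isomorphism, analytic ideals -/

/-- `I ≤_K J`. -/
def KatetovLE {X Y : Type} (I : Order.Ideal (Set X)) (J : Order.Ideal (Set Y)) : Prop :=
  ∃ f : Y → X, ∀ A ∈ I, f ⁻¹' A ∈ J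

/-- `I ≅_K J`. -/
def KatetovEquiv {X Y : Type} (I : Order.Ideal (Set X)) (J : Order.Ideal (Set Y)) : Prop :=
  KatetovLE I J ∧ KatetovLE J I

/-- Isomorphism of ideals. -/
def IdealIso {X Y : Type} (I : Order.Ideal (Set X)) (J : Order.Ideal (Set Y)) : Prop :=
  ∃ f : X ≃ Y, ∀ A : Set X, f '' A ∈ J ↔ A ∈ I

/-- An ideal is analytic if the set of characteristic functions of its members is an analytic
subset of the Cantor space `2^X` (product topology, `Bool` discrete). -/
def IsAnalyticIdeal {X : Type} (I : Order.Ideal (Set X)) : Prop :=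
  AnalyticSet {c : X → Bool | {x | c x = true} ∈ I}

/-! ## The ideals `fin^α` -/

/-- The pair `(X_α, fin^α)`, by recursion on `α`. In the limit step the ordinals `β < α` are
represented by the elements of the well-order `α.ToType` of type `α`. -/
noncomputable def finPowPair (α : Ordinal.{0}) : Σ X : Type, Order.Ideal (Set X) :=
  Ordinal.limitRecOn α
    ⟨Unit, generatedIdeal ∅⟩
    (fun α p => if α = 0 then ⟨ℕ, finIdeal⟩ else ⟨ℕ × p.1, fubiniProd finIdeal p.2⟩)
    (fun α hα p =>
      haveI : Nonempty α.ToType := Ordinal.nonempty_toType_iff.2 hα.ne_bot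
      ⟨Σ i : α.ToType, (p i.toOrd i.toOrd.2).1,
        limIdeal (bndIdeal α.ToType) fun i => (p i.toOrd i.toOrd.2).2⟩)

/-- The set `X_α`. -/
def FinPowSpace (α : Ordinal.{0}) : Type := (finPowPair α).1

/-- The ideal `fin^α` on `X_α`. -/
noncomputable def finPow (α : Ordinal.{0}) : Order.Ideal (Set (FinPowSpace α)) := (finPowPair α).2

/-- `fin^0 = {∅}` on a one-point set. -/
theorem finPowPair_zero : finPowPair 0 = ⟨Unit, generatedIdeal ∅⟩ := by
  simp [finPowPair]

theorem mem_finPow_zero (A : Set Unit) :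
    A ∈ (generatedIdeal ∅ : Order.Ideal (Set Unit)) ↔ A = ∅ := by
  constructor
  · rintro ⟨F, -, hF, hA⟩
    rw [subset_empty_iff.1 hF, sUnion_empty] at hA
    exact subset_empty_iff.1 hA
  · rintro rfl
    exact Order.Ideal.bot_mem _

theorem finPowPair_one : finPowPair 1 = ⟨ℕ, finIdeal⟩ := by
  rw [← zero_add 1, finPowPair, Ordinal.limitRecOn_add_one]
  simp

theorem finPowPair_succ (α : Ordinal.{0}) (hα : α ≠ 0) :
    finPowPair (α + 1) = ⟨ℕ × FinPowSpace α, fubiniProd finIdeal (finPow α)⟩ := by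
  rw [finPowPair, Ordinal.limitRecOn_add_one, if_neg hα]
  rfl

theorem finPowPair_limit (α : Ordinal.{0}) (hα : Order.IsSuccLimit α) [Nonempty α.ToType] :
    finPowPair α = ⟨Σ i : α.ToType, FinPowSpace i.toOrd,
      limIdeal (bndIdeal α.ToType) fun i => finPow i.toOrd⟩ := by
  rw [finPowPair, Ordinal.limitRecOn_limit _ _ _ _ hα]
  rfl

/-! ## Shelah ultrafilters and `𝓘`-ultrafilters -/

/-- Shelah ultrafilters on `ω`. No ideal on `ω` is isomorphic to `fin^0`, which lives on a
one-point set, so the first clause concerns `1 ≤ α`. -/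
def IsShelahUltrafilter (U : Ultrafilter ℕ) : Prop :=
  (∀ α : Ordinal.{0}, 1 ≤ α → α < ω₁ →
    ∃ I : Order.Ideal (Set ℕ), IdealIso I (finPow α) ∧ I ≤ dualIdeal U) ∧
  (∀ I : Order.Ideal (Set ℕ), IsAnalyticIdeal I → (∀ A ∈ I, A ∉ U) →
    ∃ α : Ordinal.{0}, α < ω₁ ∧ ∃ J : Order.Ideal (Set ℕ),
      KatetovEquiv J (finPow α) ∧ I ≤ J ∧ J ≤ dualIdeal U)

/-- `U` is an `I`-ultrafilter. -/
def IsIdealUltrafilter {X Y : Type} (I : Order.Ideal (Set X)) (U : Ultrafilter Y) : Prop :=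
  ∀ f : Y → X, ∃ A ∈ U, f '' A ∈ I

/-! ## The classical Borel ideals -/

/-- The nowhere dense subsets of `ℚ`. -/
def nwdIdeal : Order.Ideal (Set ℚ) :=
  setIdeal {A | IsNowhereDense A} isNowhereDense_empty
    (fun _ _ hAB hB => hB.mono hAB)
    (fun A B hA hB => by
      change interior (closure (A ∪ B)) = ∅
      rw [closure_union, interior_union_isClosed_of_interior_empty isClosed_closure hB]
      exact hA)

/-- The ideal `ED` on `ω × ω`. -/
def edIdeal : Order.Ideal (Set (ℕ × ℕ)) :=
  setIdeal {A | ∃ m n : ℕ, ∀ k > n, {l | (k, l) ∈ A}.encard < m}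
    ⟨1, 0, fun k _ => by simp⟩
    (fun A B hAB ⟨m, n, h⟩ => ⟨m, n, fun k hk =>
      (encard_le_encard (s := {l | (k, l) ∈ A}) (t := {l | (k, l) ∈ B})
        fun _ hl => hAB hl).trans_lt (h k hk)⟩)
    (fun _ _ ⟨m, n, h⟩ ⟨m', n', h'⟩ => ⟨m + m', max n n', fun k hk => by
      push_cast
      exact (encard_union_le _ _).trans_lt
        (ENat.add_lt_add (h k (lt_of_le_of_lt (le_max_left _ _) hk))
          (h' k (lt_of_le_of_lt (le_max_right _ _) hk)))⟩)

/-- `ED_fin`, the restriction of `ED` to `{(n, m) : m ≤ n}`. -/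
def edFinIdeal : Order.Ideal (Set {p : ℕ × ℕ | p.2 ≤ p.1}) :=
  restrictIdeal edIdeal {p : ℕ × ℕ | p.2 ≤ p.1}

theorem summable_inv_mono (A B : Set ℕ) (hAB : A ⊆ B)
    (hB : Summable fun n : B => 1 / (((n : ℕ) : ℝ) + 1)) :
    Summable fun n : A => 1 / (((n : ℕ) : ℝ) + 1) := by
  have h := hB.comp_injective (inclusion_injective hAB)
  simpa only [Function.comp_def, coe_inclusion] using h

theorem summable_inv_union (A B : Set ℕ)
    (hA : Summable fun n : A => 1 / (((n : ℕ) : ℝ) + 1))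
    (hB : Summable fun n : B => 1 / (((n : ℕ) : ℝ) + 1)) :
    Summable fun n : (A ∪ B : Set ℕ) => 1 / (((n : ℕ) : ℝ) + 1) := by
  have key : ∀ C : Set ℕ, (Summable fun n : C => 1 / (((n : ℕ) : ℝ) + 1)) ↔
      Summable (C.indicator fun n : ℕ => 1 / ((n : ℝ) + 1)) :=
    fun C => summable_subtype_iff_indicator (f := fun n : ℕ => 1 / ((n : ℝ) + 1))
  rw [key] at hA hB ⊢
  refine Summable.of_nonneg_of_le (fun n => ?_) (fun n => ?_) (hA.add hB)
  · exact indicator_nonneg (fun n _ => by positivity) n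
  · have h0 : (0 : ℝ) ≤ 1 / ((n : ℝ) + 1) := by positivity
    by_cases h1 : n ∈ A <;> by_cases h2 : n ∈ B <;> simp only [indicator, mem_union, h1, h2,
      or_self, or_true, true_or, if_true, if_false] <;> linarith

/-- The summable ideal. -/
def summableIdeal : Order.Ideal (Set ℕ) :=
  setIdeal {A | Summable fun n : A => 1 / (((n : ℕ) : ℝ) + 1)}
    (by
      change Summable fun n : (∅ : Set ℕ) => 1 / (((n : ℕ) : ℝ) + 1)
      exact summable_empty)
    (fun A B hAB hB => summable_inv_mono A B hAB hB)
    (fun A B hA hB => summable_inv_union A B hA hB)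

/-- The density zero ideal: `|A ∩ {0, …, n - 1}| / n → 0`. -/
def densityIdeal : Order.Ideal (Set ℕ) :=
  setIdeal {A | Tendsto (fun n : ℕ => ((A ∩ Iio n).ncard : ℝ) / n) atTop (𝓝 0)}
    (by simp)
    (fun A B hAB hB => squeeze_zero (fun n => by positivity)
      (fun n => by
        have : (A ∩ Iio n).ncard ≤ (B ∩ Iio n).ncard :=
          ncard_le_ncard (inter_subset_inter_left _ hAB) ((finite_Iio n).inter_of_right _)
        gcongr) hB)
    (fun A B hA hB => by
      have h := Tendsto.add hA hB
      rw [add_zero] at h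
      refine squeeze_zero (fun n => by positivity) (fun n => ?_) h
      rw [← add_div, ← Nat.cast_add, union_inter_distrib_right]
      have := ncard_union_le (A ∩ Iio n) (B ∩ Iio n)
      gcongr)

/-- The normalized Haar measure on the Cantor space `2^ω`, that is, the fair-coin product
measure. -/
noncomputable def cantorMeasure : Measure (ℕ → Bool) :=
  Measure.infinitePi fun _ : ℕ => (PMF.uniformOfFintype Bool).toMeasure

/-- The clopen subsets of `2^ω` of measure `1/2`. -/
def SoleckiSpace : Type :=
  {A : TopologicalSpace.Clopens (ℕ → Bool) // cantorMeasure (A : Set (ℕ → Bool)) = 1 / 2}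

/-- The Solecki ideal, generated by the sets `{A : x ∈ A}` for `x ∈ 2^ω`. -/
def soleckiIdeal : Order.Ideal (Set SoleckiSpace) :=
  generatedIdeal (range fun x : ℕ → Bool => {A : SoleckiSpace | x ∈ A.1})

/-!
Let `U` be a Shelah ultrafilter.

For an analytic ideal `I` and a map `f` witnessing `I ≤_K U*`, the ideal of all sets mapped by `f`
into a member of `I` is again analytic (`IsAnalyticIdeal.pullback`) and disjoint from `U`, so it
extends to an ideal Katětov equivalent to some `fin^α`; hence `I ≤_K fin^α`. The converse is
immediate from the copies of `fin^α` inside `U*`. This is `IsShelahUltrafilter.katetovLE_iff`.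

For the five ideals the same argument is applied to a Borel parametrized subfamily `(A y)` of the
ideal, which generates an analytic ideal (`isAnalyticIdeal_coverIdeal`): it suffices that for every
`α < ω₁` and `g : X_α → X` some `g⁻¹[A y]` is `fin^α`-positive
(`IsShelahUltrafilter.exists_preimage_mem`). Two properties of a family guarantee this, each proved
by induction on `α`.

* Measure. If `y` ranges over a finite measure space and each point `x` belongs to `A y` with
  measure at least `ε > 0`, the Fubini property of `fin^α` (`finPow_fubini`) produces `y`. The
  generators of the Solecki ideal are such a family. For the nowhere dense ideal, take the rationals
  outside the translates of an open set `D ⊇ ℚ` of measure less than `1 / 2`, with the translation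
  chosen in `[0, 1]`.
* Hitting. If the `A y` cover `X` and for any countably many infinite sets some `A y` meets them all,
  then `finPow_fiber_or_hitting` produces `y`: a map on `X_α` has a positive fiber, or countably many
  infinite sets such that the preimage of every set meeting all of them is positive. Graphs of
  functions are such a family in `ED_fin`, and sequences with `n ^ 2 ≤ a n` are one in both the
  summable and the density zero ideal.
-/

/-! ### Analyticity -/

/-- The ideal of the sets covered by finitely many members of the family `A`. -/
def coverIdeal {X ι : Type} (A : ι → Set X) : Order.Ideal (Set X) :=
  setIdeal {B | ∃ l : List ι, ∀ n ∈ B, ∃ y ∈ l, n ∈ A y} ⟨[], by simp⟩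
    (fun _ _ hAB ⟨l, h⟩ => ⟨l, fun n hn => h n (hAB hn)⟩)
    (fun _ _ ⟨l, h⟩ ⟨l', h'⟩ => ⟨l ++ l', fun n hn => by
      rcases hn with hn | hn
      · obtain ⟨y, hy, hny⟩ := h n hn
        exact ⟨y, List.mem_append_left _ hy, hny⟩
      · obtain ⟨y, hy, hny⟩ := h' n hn
        exact ⟨y, List.mem_append_right _ hy, hny⟩⟩)

theorem mem_coverIdeal {X ι : Type} (A : ι → Set X) (y : ι) : A y ∈ coverIdeal A :=
  ⟨[y], fun n hn => ⟨y, by simp, hn⟩⟩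

theorem isAnalyticIdeal_coverIdeal {X Y : Type} [Countable X] [MeasurableSpace Y]
    [StandardBorelSpace Y] (A : Y → Set X) (hA : ∀ n, MeasurableSet {y | n ∈ A y}) :
    IsAnalyticIdeal (coverIdeal A) := by
  have h : {c : X → Bool | {x | c x = true} ∈ coverIdeal A} = ⋃ k : ℕ,
      Prod.fst '' {p : (X → Bool) × (Fin k → Y) | ∀ n, p.1 n = true → ∃ i, n ∈ A (p.2 i)} := by
    ext c
    simp only [mem_iUnion, mem_image, mem_ofPred_eq, Prod.exists, exists_and_right, exists_eq_right]
    constructor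
    · rintro ⟨l, hl⟩
      refine ⟨l.length, l.get, fun n hn => ?_⟩
      obtain ⟨y, hy, hny⟩ := hl n hn
      obtain ⟨i, rfl⟩ := List.get_of_mem hy
      exact ⟨i, hny⟩
    · rintro ⟨k, y, hy⟩
      refine ⟨List.ofFn y, fun n hn => ?_⟩
      obtain ⟨i, hi⟩ := hy n hn
      exact ⟨y i, List.mem_ofFn.2 ⟨i, rfl⟩, hi⟩
  rw [IsAnalyticIdeal, h]
  refine AnalyticSet.iUnion fun k => MeasurableSet.analyticSet_image ?_ measurable_fst
  simp only [ofPred_forall, imp_iff_not_or, ofPred_or, ofPred_exists]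
  refine MeasurableSet.iInter fun n => MeasurableSet.union ?_ (MeasurableSet.iUnion fun i => ?_)
  · exact (measurableSet_eq_fun (f := fun p : (X → Bool) × (Fin k → Y) => p.1 n)
      (g := fun _ => true) (by fun_prop) (by fun_prop)).compl
  · exact (by fun_prop : Measurable fun p : (X → Bool) × (Fin k → Y) => p.2 i) (hA n)

/-- The sets mapped by `f` into a member of `I`. -/
def pullbackIdeal {X Y : Type} (f : Y → X) (I : Order.Ideal (Set X)) : Order.Ideal (Set Y) :=
  setIdeal {B | ∃ A ∈ I, B ⊆ f ⁻¹' A} ⟨∅, I.bot_mem, empty_subset _⟩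
    (fun _ _ hAB ⟨C, hC, h⟩ => ⟨C, hC, hAB.trans h⟩)
    (fun _ _ ⟨C, hC, h⟩ ⟨C', hC', h'⟩ => ⟨C ∪ C', I.sup_mem hC hC', union_subset_union h h'⟩)

theorem IsAnalyticIdeal.pullback {X Y : Type} [Countable X] [Countable Y]
    {I : Order.Ideal (Set X)} (hI : IsAnalyticIdeal I) (f : Y → X) :
    IsAnalyticIdeal (pullbackIdeal f I) := by
  have h : {c : Y → Bool | {x | c x = true} ∈ pullbackIdeal f I} =
      Prod.fst '' ((Prod.snd ⁻¹' {d : X → Bool | {x | d x = true} ∈ I}) ∩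
        {p : (Y → Bool) × (X → Bool) | ∀ y, p.1 y = true → p.2 (f y) = true}) := by
    ext c
    constructor
    · rintro ⟨A, hA, hc⟩
      classical
      refine ⟨(c, fun x => decide (x ∈ A)), ⟨?_, fun y hy => ?_⟩, rfl⟩
      · simpa using hA
      · simpa using hc hy
    · rintro ⟨⟨c, d⟩, ⟨hd, hcd⟩, rfl⟩
      exact ⟨_, hd, hcd⟩
  have : PolishSpace ((Y → Bool) × (X → Bool)) := ⟨⟩
  rw [IsAnalyticIdeal, h]
  refine AnalyticSet.image_of_continuous ?_ continuous_fst
  rw [inter_eq_iInter]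
  refine AnalyticSet.iInter fun b => ?_
  cases b
  · suffices hm : MeasurableSet
        {p : (Y → Bool) × (X → Bool) | ∀ y, p.1 y = true → p.2 (f y) = true} by
      simpa using hm.analyticSet_image measurable_id
    simp only [ofPred_forall, imp_iff_not_or, ofPred_or]
    exact MeasurableSet.iInter fun y => MeasurableSet.union
      (measurableSet_eq_fun (f := fun p : (Y → Bool) × (X → Bool) => p.1 y)
        (g := fun _ => true) (by fun_prop) (by fun_prop)).compl
      (measurableSet_eq_fun (by fun_prop) (by fun_prop))
  · exact hI.preimage continuous_snd

/-! ### Induction on the ideals `fin^α` -/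

/-- Induction principle for the ideals `fin^α`, `α < ω₁`. The recursion steps of the definition all
have one shape: the ideal `K` on `Z` consists of the sets `A` such that the traces of `A` along maps
`e i : Y i → Z`, for `i` in a countable linear order without a last element, belong to `J i` for all
but a bounded set of `i`. -/
theorem finPow_induction {P : ∀ {X : Type}, Order.Ideal (Set X) → Prop}
    (zero : P (generatedIdeal ∅ : Order.Ideal (Set Unit)))
    (step : ∀ {L Z : Type} [LinearOrder L] [Nonempty L] [NoMaxOrder L] [Countable L]
      {Y : L → Type} (J : ∀ i, Order.Ideal (Set (Y i))) (K : Order.Ideal (Set Z))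
      (e : ∀ i, Y i → Z), (∀ i, P (J i)) →
      (∀ A, A ∈ K ↔ BddAbove {i | e i ⁻¹' A ∉ J i}) → P K)
    {α : Ordinal.{0}} (hα : α < ω₁) : P (finPow α) := by
  have fin_iff : ∀ S : Set ℕ, S ∈ finIdeal ↔ BddAbove S := fun S =>
    ⟨fun h => Set.Finite.bddAbove h, fun h => h.finite⟩
  induction α using Ordinal.limitRecOn with
  | zero => change P (finPowPair 0).2; rw [finPowPair_zero]; exact zero
  | add_one α ih =>
    have ih := ih ((Order.lt_add_one_iff.2 le_rfl).trans hα)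
    rcases eq_or_ne α 0 with rfl | h0
    · rw [zero_add]
      change P (finPowPair 1).2
      rw [finPowPair_one]
      refine step (L := ℕ) (Y := fun _ => Unit) (fun _ => generatedIdeal ∅) finIdeal
        (fun n _ => n) (fun _ => zero) fun A => ?_
      rw [fin_iff]
      have : {n : ℕ | (fun _ : Unit => n) ⁻¹' A ∉ (generatedIdeal ∅ : Order.Ideal (Set Unit))}
          = A := by
        ext n
        simp [mem_finPow_zero, Set.eq_empty_iff_forall_notMem]
      rw [this]
    · change P (finPowPair (α + 1)).2
      rw [finPowPair_succ α h0]
      exact step (L := ℕ) (Y := fun _ => FinPowSpace α) (fun _ => finPow α) _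
        (fun n y => (n, y)) (fun _ => ih) fun A => fin_iff _
  | limit α hlim ih =>
    have : Nonempty α.ToType := Ordinal.nonempty_toType_iff.2 hlim.ne_bot
    have : Countable α.ToType := by
      rw [← Cardinal.mk_le_aleph0_iff, Cardinal.mk_toType]
      have := Cardinal.lt_ord.1 (by simpa using hα : α < (Cardinal.aleph 1).ord)
      rw [← Cardinal.succ_aleph0] at this
      exact Order.lt_succ_iff.1 this
    have : NoMaxOrder α.ToType := ⟨fun i => by
      have hi : (i.toOrd : Ordinal) + 1 < α := hlim.add_one_lt i.toOrd.2
      refine ⟨Ordinal.ToType.mk ⟨(i.toOrd : Ordinal) + 1, hi⟩, ?_⟩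
      rw [← Ordinal.ToType.mk.symm.lt_iff_lt, OrderIso.symm_apply_apply]
      exact Subtype.mk_lt_mk.2 (Order.lt_add_one_iff.2 (le_refl (i.toOrd : Ordinal)))⟩
    change P (finPowPair α).2
    rw [finPowPair_limit α hlim]
    exact step (fun i : α.ToType => finPow i.toOrd) _ (fun i y => ⟨i, y⟩)
      (fun i => ih _ i.toOrd.2 (i.toOrd.2.trans hα)) fun A => Iff.rfl

/-- The Fubini property of `fin^α`: if every section `R x`, `x ∈ X_α`, has measure at least `ε`, then
the points `y` for which `{x | y ∈ R x}` is `fin^α`-positive contain a measurable set of measure at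
least `ε`. In the induction step this set is the upper limit of the sets obtained for the pieces. -/
theorem finPow_fubini {Ω : Type*} [MeasurableSpace Ω] (μ : Measure Ω) [IsFiniteMeasure μ]
    (ε : ENNReal) {α : Ordinal.{0}} (hα : α < ω₁) (R : FinPowSpace α → Set Ω)
    (hR : ∀ x, MeasurableSet (R x)) (hε : ∀ x, ε ≤ μ (R x)) :
    ∃ B, MeasurableSet B ∧ ε ≤ μ B ∧ ∀ y ∈ B, {x | y ∈ R x} ∉ finPow α := by
  refine finPow_induction (P := fun {X} K => ∀ R : X → Set Ω, (∀ x, MeasurableSet (R x)) →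
    (∀ x, ε ≤ μ (R x)) → ∃ B, MeasurableSet B ∧ ε ≤ μ B ∧ ∀ y ∈ B, {x | y ∈ R x} ∉ K)
    ?_ ?_ hα R hR hε
  · intro R hR hε
    refine ⟨R (), hR _, hε _, fun y hy h => ?_⟩
    exact (Set.ext_iff.1 ((mem_finPow_zero _).1 h) ()).1 hy
  · intro L Z _ _ _ _ Y J K e ih hK R hR hε
    choose B hBm hBε hB using fun i => ih i (fun y => R (e i y)) (fun _ => hR _) (fun _ => hε _)
    have hm : ∀ j : L, MeasurableSet (⋃ i ∈ Ioi j, B i) := fun j =>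
      MeasurableSet.biUnion (to_countable _) fun i _ => hBm i
    refine ⟨⋂ j, ⋃ i ∈ Ioi j, B i, MeasurableSet.iInter hm, ?_, fun y hy h => ?_⟩
    · have hanti : Antitone fun j : L => ⋃ i ∈ Ioi j, B i := fun a b hab =>
        biUnion_subset_biUnion_left (Ioi_subset_Ioi hab)
      rw [hanti.measure_iInter (fun j => (hm j).nullMeasurableSet)
        ⟨Classical.arbitrary L, measure_ne_top _ _⟩]
      refine le_iInf fun j => ?_
      obtain ⟨i, hi⟩ := exists_gt j
      exact (hBε i).trans (measure_mono (subset_biUnion_of_mem (u := B) hi))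
    · obtain ⟨j, hj⟩ := (hK _).1 h
      obtain ⟨i, hi, hyi⟩ := mem_iUnion₂.1 (mem_iInter.1 hy j)
      exact not_le_of_gt hi (hj (hB i y hyi))

/-- For every `f : X_α → X`, either some fiber of `f` is `fin^α`-positive (outside `fin^α`), or there is
a countable family of infinite subsets of `X` such that every set that meets all of them has a
`fin^α`-positive preimage. -/
theorem finPow_fiber_or_hitting {X : Type} {α : Ordinal.{0}} (hα : α < ω₁)
    (f : FinPowSpace α → X) :
    (∃ p, f ⁻¹' {p} ∉ finPow α) ∨ ∃ E : Set (Set X), E.Countable ∧ (∀ S ∈ E, S.Infinite) ∧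
      ∀ A : Set X, (∀ S ∈ E, (A ∩ S).Nonempty) → f ⁻¹' A ∉ finPow α := by
  refine finPow_induction (P := fun {Z} K => ∀ f : Z → X, (∃ p, f ⁻¹' {p} ∉ K) ∨
    ∃ E : Set (Set X), E.Countable ∧ (∀ S ∈ E, S.Infinite) ∧
      ∀ A : Set X, (∀ S ∈ E, (A ∩ S).Nonempty) → f ⁻¹' A ∉ K) ?_ ?_ hα f
  · refine fun f => Or.inl ⟨f (), fun h => ?_⟩
    exact (Set.ext_iff.1 ((mem_finPow_zero _).1 h) ()).1 rfl
  · intro L Z _ _ _ _ Y J K e ih hK f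
    by_cases hb : BddAbove {i | ∀ p, (fun y => f (e i y)) ⁻¹' {p} ∈ J i}
    · -- Beyond `j₀`, the restriction to `Y i` has a positive fiber, over `p i`.
      obtain ⟨j₀, hj₀⟩ := hb
      have hp : ∀ i : Ioi j₀, ∃ p, (fun y => f (e i y)) ⁻¹' {p} ∉ J i := fun i => by
        by_contra! h
        exact not_le_of_gt i.2 (hj₀ h)
      choose p hp using hp
      by_cases hq : ∃ q, ¬ BddAbove {i | ∃ h : j₀ < i, p ⟨i, h⟩ = q}
      · obtain ⟨q, hq⟩ := hq
        refine Or.inl ⟨q, fun h => hq (((hK _).1 h).mono ?_)⟩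
        rintro i ⟨hi, rfl⟩
        exact hp ⟨i, hi⟩
      · push Not at hq
        refine Or.inr ⟨range fun j : L => p '' {i | j < i}, countable_range _, ?_, ?_⟩
        · rintro _ ⟨j, rfl⟩ hfin
          -- Finitely many values with bounded fibers cannot exhaust a final segment.
          have hbd := (hfin.bddAbove_biUnion (S := fun q => {i | ∃ h : j₀ < i, p ⟨i, h⟩ = q})).2
            fun q _ => hq q
          obtain ⟨m, hm⟩ := hbd
          obtain ⟨i, hi⟩ := exists_gt (max m (max j₀ j))
          simp only [max_lt_iff] at hi
          exact not_le_of_gt hi.1 (hm (mem_iUnion₂.2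
            ⟨p ⟨i, hi.2.1⟩, mem_image_of_mem _ hi.2.2, hi.2.1, rfl⟩))
        · intro A hA h
          obtain ⟨j, hj⟩ := (hK _).1 h
          obtain ⟨_, hqA, i, hi, rfl⟩ := hA _ ⟨j, rfl⟩
          refine not_le_of_gt hi (hj fun h' => hp i ((J i).lower ?_ h'))
          intro y hy
          have hfy : f (e i y) = p i := hy
          exact mem_preimage.2 (mem_preimage.2 (hfy.symm ▸ hqA))
    · -- Unboundedly many restrictions fall under the second alternative.
      have key : ∀ i : {i | ∀ p, (fun y => f (e i y)) ⁻¹' {p} ∈ J i}, ∃ E : Set (Set X),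
          E.Countable ∧ (∀ S ∈ E, S.Infinite) ∧ ∀ A : Set X, (∀ S ∈ E, (A ∩ S).Nonempty) →
            (fun y => f (e i y)) ⁻¹' A ∉ J i := fun i =>
        (ih i fun y => f (e i y)).resolve_left fun ⟨p, hp⟩ => hp (i.2 p)
      choose E hEc hEi hE using key
      refine Or.inr ⟨⋃ i, E i, countable_iUnion hEc, ?_, fun A hA h => hb (((hK _).1 h).mono ?_)⟩
      · simp only [mem_iUnion]
        rintro S ⟨i, hS⟩
        exact hEi i S hS
      · exact fun i hi => hE ⟨i, hi⟩ A fun S hS => hA S (mem_iUnion.2 ⟨_, hS⟩)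

/-- A family of sets that covers `X` and has, for any countably many infinite sets, a member meeting
them all, does not generate an ideal Katětov below `fin^α`. -/
theorem exists_preimage_notMem_finPow_of_hitting {X ι : Type} [Nonempty ι] (A : ι → Set X)
    (hpt : ∀ p, ∃ y, p ∈ A y)
    (hhit : ∀ E : ℕ → Set X, (∀ n, (E n).Infinite) → ∃ y, ∀ n, (A y ∩ E n).Nonempty)
    {α : Ordinal.{0}} (hα : α < ω₁) (f : FinPowSpace α → X) :
    ∃ y, f ⁻¹' A y ∉ finPow α := by
  rcases finPow_fiber_or_hitting hα f with ⟨p, hp⟩ | ⟨E, hEc, hEi, hE⟩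
  · obtain ⟨y, hy⟩ := hpt p
    exact ⟨y, fun h => hp ((finPow α).lower (preimage_mono (singleton_subset_iff.2 hy)) h)⟩
  · rcases E.eq_empty_or_nonempty with rfl | hne
    · exact ⟨Classical.arbitrary ι, hE _ (by simp)⟩
    · obtain ⟨E, rfl⟩ := hEc.exists_eq_range hne
      obtain ⟨y, hy⟩ := hhit E fun n => hEi _ ⟨n, rfl⟩
      exact ⟨y, hE _ (by rintro _ ⟨n, rfl⟩; exact hy n)⟩

/-! ### The families in the five ideals -/

/-- The graph of `a`, inside `{(n, m) : m ≤ n}`. -/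
def graphFamily (a : ℕ → ℕ) : Set {p : ℕ × ℕ | p.2 ≤ p.1} := {p | a p.1.1 = p.1.2}

/-- The terms `a n` of the sequence that are at least `n ^ 2`. -/
def sparseFamily (a : ℕ → ℕ) : Set ℕ := {m | ∃ n, a n = m ∧ n ^ 2 ≤ m}

/-- The rationals outside the translate `D + y`. -/
def translateFamily (D : Set ℝ) (y : ℝ) : Set ℚ := {q | (q : ℝ) - y ∉ D}

theorem measurableSet_graphFamily (p : {p : ℕ × ℕ | p.2 ≤ p.1}) :
    MeasurableSet {a | p ∈ graphFamily a} :=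
  measurableSet_eq_fun (f := fun a : ℕ → ℕ => a p.1.1) (by fun_prop) measurable_const

theorem measurableSet_sparseFamily (m : ℕ) : MeasurableSet {a | m ∈ sparseFamily a} := by
  change MeasurableSet {a : ℕ → ℕ | ∃ n, a n = m ∧ n ^ 2 ≤ m}
  simp only [ofPred_exists, ofPred_and]
  exact MeasurableSet.iUnion fun n : ℕ =>
    (measurableSet_eq_fun (f := fun a : ℕ → ℕ => a n) (by fun_prop) measurable_const).inter
      (MeasurableSet.const _)

theorem graphFamily_mem_edFinIdeal (a : ℕ → ℕ) : graphFamily a ∈ edFinIdeal := by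
  refine ⟨2, 0, fun k _ => ?_⟩
  refine lt_of_le_of_lt (b := 1) (encard_le_one_iff.2 ?_) (by norm_num)
  rintro l l' ⟨p, hp, hpe⟩ ⟨p', hp', hpe'⟩
  change a p.1.1 = p.1.2 at hp
  change a p'.1.1 = p'.1.2 at hp'
  rw [hpe] at hp
  rw [hpe'] at hp'
  exact hp.symm.trans hp'

theorem graphFamily_hitting (E : ℕ → Set {p : ℕ × ℕ | p.2 ≤ p.1}) (hE : ∀ n, (E n).Infinite) :
    ∃ a, ∀ n, (graphFamily a ∩ E n).Nonempty := by
  classical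
  -- Each column is finite, so every `E n` meets columns arbitrarily far to the right.
  have hfar : ∀ n k, ∃ p ∈ E n, k < p.1.1 := by
    intro n k
    by_contra! h
    refine hE n (Set.Finite.subset (s := {p : {p : ℕ × ℕ | p.2 ≤ p.1} | p.1.1 ≤ k}) ?_ h)
    refine Set.Finite.of_finite_image (f := Subtype.val)
      (((finite_Iic k).prod (finite_Iic k)).subset ?_) Subtype.val_injective.injOn
    rintro _ ⟨p, hp, rfl⟩
    exact ⟨hp, (show p.1.2 ≤ k from le_trans p.2 hp)⟩
  choose g hgE hg using hfar
  -- `q n` is a point of `E n`, in a column to the right of that of `q (n - 1)`.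
  let q : ℕ → {p : ℕ × ℕ | p.2 ≤ p.1} := fun n => Nat.rec (g 0 0) (fun n p => g (n + 1) p.1.1) n
  have hqE : ∀ n, q n ∈ E n := fun n => by cases n <;> exact hgE _ _
  have hmono : StrictMono fun n => (q n).1.1 := strictMono_nat_of_lt_succ fun n => hg _ _
  refine ⟨fun c => if h : ∃ n, (q n).1.1 = c then (q h.choose).1.2 else 0,
    fun n => ⟨q n, ?_, hqE n⟩⟩
  have h : ∃ m, (q m).1.1 = (q n).1.1 := ⟨n, rfl⟩
  simp only [graphFamily, mem_ofPred_eq]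
  rw [dif_pos h, hmono.injective h.choose_spec]

theorem sparseFamily_hitting (E : ℕ → Set ℕ) (hE : ∀ n, (E n).Infinite) :
    ∃ a, ∀ n, (sparseFamily a ∩ E n).Nonempty := by
  choose a haE ha using fun n => (hE n).exists_gt (n ^ 2)
  exact ⟨a, fun n => ⟨a n, ⟨n, rfl, (ha n).le⟩, haE n⟩⟩

theorem sparseFamily_mem_summableIdeal (a : ℕ → ℕ) : sparseFamily a ∈ summableIdeal := by
  change Summable fun m : sparseFamily a => 1 / (((m : ℕ) : ℝ) + 1)
  choose n hn hle using fun m : sparseFamily a => m.2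
  have hinj : Function.Injective n := fun m m' h => Subtype.ext (by rw [← hn m, h, hn m'])
  have hs : Summable fun k : ℕ => 1 / ((k : ℝ) ^ 2 + 1) := by
    refine Summable.of_nonneg_of_le (fun k => by positivity) (fun k => ?_)
      ((summable_nat_add_iff 1).2 (Real.summable_one_div_nat_pow.2 one_lt_two)|>.mul_left 2)
    rw [mul_one_div, div_le_div_iff₀ (by positivity) (by positivity)]
    push_cast
    nlinarith [sq_nonneg ((k : ℝ) - 1)]
  refine Summable.of_nonneg_of_le (fun m => by positivity) (fun m => ?_) (hs.comp_injective hinj)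
  have : ((n m : ℝ)) ^ 2 ≤ (m : ℕ) := by exact_mod_cast hle m
  simp only [Function.comp]
  gcongr

theorem sparseFamily_mem_densityIdeal (a : ℕ → ℕ) : sparseFamily a ∈ densityIdeal := by
  change Tendsto (fun N : ℕ => ((sparseFamily a ∩ Iio N).ncard : ℝ) / N) atTop (𝓝 0)
  have hcard : ∀ N : ℕ, (sparseFamily a ∩ Iio N).ncard ≤ N.sqrt + 1 := by
    intro N
    have hsub : sparseFamily a ∩ Iio N ⊆ a '' Iio (N.sqrt + 1) := by
      rintro m ⟨⟨n, rfl, hn⟩, hm⟩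
      exact ⟨n, Nat.lt_succ_of_le (Nat.le_sqrt'.2 (hn.trans (le_of_lt hm))), rfl⟩
    refine (ncard_le_ncard hsub ((finite_Iio _).image a)).trans
      ((ncard_image_le (finite_Iio _)).trans ?_)
    simp [ncard_eq_toFinset_card']
  have hlim : Tendsto (fun N : ℕ => 1 / Real.sqrt N + 1 / (N : ℝ)) atTop (𝓝 0) := by
    have h1 : Tendsto (fun N : ℕ => Real.sqrt N) atTop atTop :=
      Real.tendsto_sqrt_atTop.comp tendsto_natCast_atTop_atTop
    simpa using (h1.inv_tendsto_atTop).add (tendsto_one_div_atTop_nhds_zero_nat (𝕜 := ℝ))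
  refine squeeze_zero (fun N => by positivity) (fun N => ?_) hlim
  have h2 : ((sparseFamily a ∩ Iio N).ncard : ℝ) ≤ Real.sqrt N + 1 := by
    have : ((sparseFamily a ∩ Iio N).ncard : ℝ) ≤ (N.sqrt : ℝ) + 1 := by exact_mod_cast hcard N
    linarith [Real.nat_sqrt_le_real_sqrt (a := N)]
  calc ((sparseFamily a ∩ Iio N).ncard : ℝ) / N ≤ (Real.sqrt N + 1) / N := by gcongr
    _ = 1 / Real.sqrt N + 1 / N := by rw [add_div, Real.sqrt_div_self', ]

theorem isNowhereDense_translateFamily {D : Set ℝ} (hD : IsOpen D)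
    (hQ : range ((↑) : ℚ → ℝ) ⊆ D) (y : ℝ) : IsNowhereDense (translateFamily D y) := by
  have hcont : Continuous fun q : ℚ => (q : ℝ) - y := by fun_prop
  have hcl : IsClosed (translateFamily D y) := hD.isClosed_compl.preimage hcont
  rw [hcl.isNowhereDense_iff]
  by_contra hne
  obtain ⟨W, hW, hWi⟩ := Rat.isEmbedding_coe_real.isOpen_iff.1
    (isOpen_interior (s := translateFamily D y))
  obtain ⟨q, hq⟩ := nonempty_iff_ne_empty.2 hne
  -- The open set `W ∩ (D + y)` is nonempty because `D + y` is dense.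
  have hcr : Continuous fun r : ℝ => r - y := by fun_prop
  have hDy : Dense ((fun r : ℝ => r - y) ⁻¹' D) :=
    ((Rat.denseRange_cast (𝕜 := ℝ)).mono hQ).preimage (Homeomorph.subRight y).isOpenMap
  obtain ⟨r, hr⟩ := hDy.inter_open_nonempty W hW ⟨q, (hWi ▸ hq : q ∈ ((↑) : ℚ → ℝ) ⁻¹' W)⟩
  obtain ⟨_, ⟨hsW, hsD⟩, s, rfl⟩ := (Rat.denseRange_cast (𝕜 := ℝ)).inter_open_nonempty _
    (hW.inter (hD.preimage hcr)) ⟨r, hr⟩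
  have hs : s ∈ interior (translateFamily D y) := hWi ▸ hsW
  exact interior_subset hs hsD

theorem half_le_volume_translateFamily {D : Set ℝ} (hD : IsOpen D) (hDv : volume D < 1 / 2)
    (q : ℚ) : 1 / 2 ≤ volume.restrict (Icc (0 : ℝ) 1) {y | q ∈ translateFamily D y} := by
  have hm : MeasurableSet {y : ℝ | (q : ℝ) - y ∈ D} :=
    (hD.preimage (by fun_prop : Continuous fun y : ℝ => (q : ℝ) - y)).measurableSet
  have hsmall : volume.restrict (Icc (0 : ℝ) 1) {y : ℝ | (q : ℝ) - y ∈ D} ≤ 1 / 2 := by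
    refine (Measure.restrict_apply_le _ _).trans ?_
    have := (Measure.measurePreserving_sub_left volume (q : ℝ)).measure_preimage
      hD.measurableSet.nullMeasurableSet
    exact this.le.trans hDv.le
  change 1 / 2 ≤ volume.restrict (Icc (0 : ℝ) 1) {y : ℝ | (q : ℝ) - y ∈ D}ᶜ
  rw [measure_compl hm (measure_ne_top _ _)]
  simp only [Measure.restrict_apply_univ, Real.volume_Icc, sub_zero, ENNReal.ofReal_one]
  calc (1 / 2 : ENNReal) = 1 - 1 / 2 := by norm_num
    _ ≤ _ := tsub_le_tsub_left hsmall 1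

instance : IsProbabilityMeasure cantorMeasure := by
  unfold cantorMeasure; infer_instance

/-! ### Shelah ultrafilters -/

/-- Let `(A y)` be a Borel parametrized family of sets such that no ideal containing all of them is
Katětov below some `fin^α`. Then the preimage of some `A y` belongs to the ultrafilter. -/
theorem IsShelahUltrafilter.exists_preimage_mem {U : Ultrafilter ℕ} (hU : IsShelahUltrafilter U)
    {X Y : Type} [MeasurableSpace Y] [StandardBorelSpace Y] (A : Y → Set X)
    (hA : ∀ x, MeasurableSet {y | x ∈ A y})
    (hK : ∀ α : Ordinal.{0}, α < ω₁ → ∀ g : FinPowSpace α → X, ∃ y, g ⁻¹' A y ∉ finPow α)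
    (f : ℕ → X) : ∃ y, f ⁻¹' A y ∈ U := by
  by_contra! hne
  have hcov : coverIdeal (fun y => f ⁻¹' A y) ≤ dualIdeal U := by
    rintro B ⟨l, hl⟩
    have : ∀ᶠ n in (U : Filter ℕ), ∀ y ∈ {y | y ∈ l}, n ∉ f ⁻¹' A y :=
      (Filter.eventually_all_finite (List.finite_toSet l)).2
        fun y _ => Ultrafilter.compl_mem_iff_notMem.2 (hne y)
    refine mem_of_superset this fun n hn hnB => ?_
    obtain ⟨y, hy, hny⟩ := hl n hnB
    exact hn y hy hny
  obtain ⟨α, hα, J, ⟨⟨h, hh⟩, -⟩, hIJ, -⟩ := hU.2 _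
    (isAnalyticIdeal_coverIdeal (fun y => f ⁻¹' A y) fun n => hA (f n))
    (fun B hB hBU => Ultrafilter.compl_mem_iff_notMem.1 (hcov hB) hBU)
  obtain ⟨y, hy⟩ := hK α hα (f ∘ h)
  exact hy (hh _ (hIJ (mem_coverIdeal (fun y => f ⁻¹' A y) y)))

/-- Forward, the second clause of the definition applies to the pullback of `I` along a Katětov
reduction; backward, the first clause puts a copy of `fin^α` inside the dual ideal. -/
theorem IsShelahUltrafilter.katetovLE_iff {U : Ultrafilter ℕ} (hU : IsShelahUltrafilter U)
    {I : Order.Ideal (Set ℕ)} (hI : IsAnalyticIdeal I) :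
    KatetovLE I (dualIdeal U) ↔ ∃ α : Ordinal.{0}, α < ω₁ ∧ KatetovLE I (finPow α) := by
  constructor
  · rintro ⟨f, hf⟩
    obtain ⟨α, hα, J, ⟨⟨h, hh⟩, -⟩, hIJ, -⟩ := hU.2 _ (hI.pullback f) (by
      rintro B ⟨A, hA, hBA⟩ hB
      exact Ultrafilter.compl_mem_iff_notMem.1 (hf A hA) (mem_of_superset hB hBA))
    exact ⟨α, hα, f ∘ h, fun A hA => hh _ (hIJ ⟨A, hA, subset_rfl⟩)⟩
  · rintro ⟨α, hα, f, hf⟩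
    rcases eq_or_ne α 0 with rfl | h0
    · -- Since `fin^0 = {∅}`, no member of `I` contains the value `n` of `f`, so every member has empty
      -- preimage under the constant map `n`.
      have hx : ∃ n, ∀ A ∈ I, n ∉ A := by
        revert f
        unfold FinPowSpace finPow
        rw [finPowPair_zero]
        intro f hf
        exact ⟨f (), fun A hA hn =>
          (Set.ext_iff.1 ((mem_finPow_zero _).1 (hf A hA)) ()).1 hn⟩
      obtain ⟨n, hn⟩ := hx
      refine ⟨fun _ => n, fun A hA => ?_⟩
      rw [preimage_const_of_notMem (hn A hA)]
      exact (dualIdeal U).bot_mem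
    · obtain ⟨J, ⟨e, he⟩, hJ⟩ := hU.1 α (Order.one_le_iff_ne_zero.2 h0) hα
      refine ⟨f ∘ e, fun A hA => hJ ((he _).1 ?_)⟩
      rw [preimage_comp, image_preimage_eq _ e.surjective]
      exact hf A hA

/-- An ultrafilter containing a preimage of a member of `I` under every map is an
`I`-ultrafilter. -/
theorem isIdealUltrafilter_of_preimage_mem {X Y ι : Type} {I : Order.Ideal (Set X)}
    {U : Ultrafilter Y} {A : ι → Set X} (hA : ∀ y, A y ∈ I)
    (h : ∀ f : Y → X, ∃ y, f ⁻¹' A y ∈ U) : IsIdealUltrafilter I U := fun f => by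
  obtain ⟨y, hy⟩ := h f
  exact ⟨_, hy, I.lower (image_preimage_subset _ _) (hA y)⟩

namespace IsShelahUltrafilter

variable {U : Ultrafilter ℕ}

/-- By the Fubini property, positive measure of every `{y | x ∈ A y}`, bounded away from zero, keeps
the family `A` from generating an ideal Katětov below `fin^α`. -/
theorem exists_preimage_mem_of_measure (hU : IsShelahUltrafilter U) {X Y : Type}
    [MeasurableSpace Y] [StandardBorelSpace Y] (μ : Measure Y) [IsFiniteMeasure μ] {ε : ENNReal}
    (hε : ε ≠ 0) (A : Y → Set X) (hA : ∀ x, MeasurableSet {y | x ∈ A y})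
    (hμ : ∀ x, ε ≤ μ {y | x ∈ A y}) (f : ℕ → X) : ∃ y, f ⁻¹' A y ∈ U := by
  refine hU.exists_preimage_mem A hA (fun α hα g => ?_) f
  obtain ⟨B, -, hBε, hB⟩ := finPow_fubini μ ε hα (fun z => {y | g z ∈ A y})
    (fun _ => hA _) (fun _ => hμ _)
  obtain ⟨y, hy⟩ := nonempty_of_measure_ne_zero ((pos_iff_ne_zero.2 hε).trans_le hBε).ne'
  exact ⟨y, hB y hy⟩

theorem exists_preimage_mem_of_hitting (hU : IsShelahUltrafilter U) {X Y : Type} [Nonempty Y]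
    [MeasurableSpace Y] [StandardBorelSpace Y] (A : Y → Set X)
    (hA : ∀ x, MeasurableSet {y | x ∈ A y}) (hpt : ∀ x, ∃ y, x ∈ A y)
    (hhit : ∀ E : ℕ → Set X, (∀ n, (E n).Infinite) → ∃ y, ∀ n, (A y ∩ E n).Nonempty)
    (f : ℕ → X) : ∃ y, f ⁻¹' A y ∈ U :=
  hU.exists_preimage_mem A hA
    (fun _ hα g => exists_preimage_notMem_finPow_of_hitting A hpt hhit hα g) f

theorem isIdealUltrafilter_solecki (hU : IsShelahUltrafilter U) :
    IsIdealUltrafilter soleckiIdeal U := by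
  refine isIdealUltrafilter_of_preimage_mem (A := fun x => {C : SoleckiSpace | x ∈ C.1})
    (fun x => ⟨_, finite_singleton _, singleton_subset_iff.2 ⟨x, rfl⟩, ?_⟩)
    (hU.exists_preimage_mem_of_measure cantorMeasure (ε := 1 / 2) (by simp) _
      (fun C => C.1.isClopen.isOpen.measurableSet) fun C => C.2.ge)
  rw [sUnion_singleton]

theorem isIdealUltrafilter_nwd (hU : IsShelahUltrafilter U) : IsIdealUltrafilter nwdIdeal U := by
  obtain ⟨D, hQ, hD, hDv⟩ := (range ((↑) : ℚ → ℝ)).exists_isOpen_lt_of_lt (μ := volume) (1 / 2)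
    (by rw [(countable_range _).measure_zero]; simp)
  refine isIdealUltrafilter_of_preimage_mem (A := translateFamily D)
    (fun y => isNowhereDense_translateFamily hD hQ y)
    (hU.exists_preimage_mem_of_measure (volume.restrict (Icc (0 : ℝ) 1)) (ε := 1 / 2) (by simp) _
      (fun q => ?_) (half_le_volume_translateFamily hD hDv))
  exact (hD.preimage (by fun_prop : Continuous fun y : ℝ => (q : ℝ) - y)).measurableSet.compl

theorem isIdealUltrafilter_edFin (hU : IsShelahUltrafilter U) : IsIdealUltrafilter edFinIdeal U :=
  isIdealUltrafilter_of_preimage_mem graphFamily_mem_edFinIdeal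
    (hU.exists_preimage_mem_of_hitting graphFamily measurableSet_graphFamily
      (fun p => ⟨fun _ => p.1.2, rfl⟩) graphFamily_hitting)

theorem exists_preimage_sparseFamily_mem (hU : IsShelahUltrafilter U) (f : ℕ → ℕ) :
    ∃ a, f ⁻¹' sparseFamily a ∈ U :=
  hU.exists_preimage_mem_of_hitting sparseFamily measurableSet_sparseFamily
    (fun m => ⟨fun _ => m, 0, rfl, by simp⟩) sparseFamily_hitting f

end IsShelahUltrafilter

theorem mainTheorem2 (U : Ultrafilter ℕ) (hU : IsShelahUltrafilter U) :
    (IsIdealUltrafilter soleckiIdeal U ∧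
      IsIdealUltrafilter nwdIdeal U ∧
      IsIdealUltrafilter edFinIdeal U ∧
      IsIdealUltrafilter summableIdeal U ∧
      IsIdealUltrafilter densityIdeal U) ∧
    (∀ I : Order.Ideal (Set ℕ), IsAnalyticIdeal I →
      (KatetovLE I (dualIdeal U) ↔ ∃ α : Ordinal.{0}, α < ω₁ ∧ KatetovLE I (finPow α))) :=
  ⟨⟨hU.isIdealUltrafilter_solecki, hU.isIdealUltrafilter_nwd, hU.isIdealUltrafilter_edFin,
    isIdealUltrafilter_of_preimage_mem sparseFamily_mem_summableIdeal
      hU.exists_preimage_sparseFamily_mem,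
    isIdealUltrafilter_of_preimage_mem sparseFamily_mem_densityIdeal
      hU.exists_preimage_sparseFamily_mem⟩,
    fun _ hI => hU.katetovLE_iff hI⟩
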